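/- Let $X$ be a compact metric space, $T:X\to X$ continuous, and $h>0$. Write $h_{\mathrm{top}}$ for topological entropy. For a $T$-invariant Borel probability measure $\nu$ let $h_\nu(T)$ be its measure-theoretic entropy, and for continuous $\varphi:X\to\mathbb R$ put $$P(T,\varphi)=\sup\Big\{h_\nu(T)+\int_X\varphi\,d\nu:\ \nu \text{ a } T\text{-invariant Borel probability measure on } X\Big\}.$$ Continuous functions $\varphi,\widetilde\varphi:X\to\mathbb R$ are co-homologous if $\widetilde\varphi=\varphi+\chi-\chi\circ T$ for some continuous $\chi:X\to\mathbb R$. The function $\varphi$ is hyperbolic for $T$ if $\sup_X\frac1n\sum_{j=0}^{n-1}\varphi\circ T^j<P(T,\varphi)$ for some integer $n\ge1$, and it satisfies the bounded range condition if $\sup_X\varphi-\inf_X\varphi<h_{\mathrm{top}}(T)$. **Lemma.** Let $X',X''\subseteq X$ be disjoint compact sets with $T(X')\subseteq X'$, $T(X'')\subseteq X''$, $X''\neq\emptyset$ and $h_{\mathrm{top}}(T|_{X'})>0$. Let $\varphi:X\to(-\infty,0]$ be a continuous function that vanishes on $X'$ and satisfies $\sup_{X''}\varphi<-h$. Then $$\sup_X\varphi<P(T,\varphi),$$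 and every continuous function $\widetilde\varphi:X\to\mathbb R$ that is co-homologous to $\varphi$ satisfies $$\sup_X\widetilde\varphi-\inf_X\widetilde\varphi>h.$$ Moreover, for such $T$ hyperbolicity is strictly weaker than the bounded range condition, in the following sense. Every continuous $\psi:X\to\mathbb R$ that satisfies the bounded range condition satisfies $\sup_X\psi<P(T,\psi)$, and so is hyperbolic for $T$. If $h_{\mathrm{top}}(T)<\infty$, there is a continuous $\psi:X\to\mathbb R$ with $\sup_X\psi<P(T,\psi)$ (so $\psi$ is hyperbolic for $T$) such that no continuous function co-homologous to $\psi$ satisfies the bounded range condition. -/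

import Mathlib

open MeasureTheory Filter Set

noncomputable section

namespace ThermoFormalism

/-- The topological entropy of `T : X → X` (Bowen's definition), as an extended real. -/
def topEntropy {X : Type*} [UniformSpace X] (T : X → X) : EReal :=
  Dynamics.coverEntropy T univ

/-- The Shannon entropy `-∑ μ(A_i) log μ(A_i)` of the finite partition of `X` into the fibres
`A_i = f ⁻¹' {i}` of a map `f` with values in a finite type (empty fibres contribute `0`). -/
def shannonEntropy {X ι : Type*} [MeasurableSpace X] [Fintype ι] (μ : Measure X) (f : X → ι) : ℝ :=
  ∑ i, Real.negMulLog (μ.real (f ⁻¹' {i}))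

/-- The itinerary of length `n` of a point with respect to the partition into the fibres of `f`.
The fibres of this map are the cells of the join of the preimages under `T^0, …, T^(n-1)` of the
partition given by `f`. -/
def itinerary {X ι : Type*} (T : X → X) (f : X → ι) (n : ℕ) (x : X) : Fin n → ι :=
  fun j => f (T^[j] x)

/-- The entropy of `T` with respect to `μ` and the partition into the fibres of `f`:
the limit of `1/n` times the Shannon entropy of the `n`-th refined partition. For an invariant
probability measure the limit exists by subadditivity, and so it equals the upper limit. -/
def partitionEntropy {X ι : Type*} [MeasurableSpace X] [Fintype ι] (μ : Measure X) (T : X → X)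
    (f : X → ι) : EReal :=
  limsup (fun n : ℕ => ((shannonEntropy μ (itinerary T f n) / n : ℝ) : EReal)) atTop

/-- The measure-theoretic (Kolmogorov--Sinai) entropy of `T` with respect to `μ`: the supremum of
the entropies with respect to all finite measurable partitions. -/
def measureEntropy {X : Type*} [MeasurableSpace X] (μ : Measure X) (T : X → X) : EReal :=
  ⨆ (k : ℕ) (f : X → Fin k) (_ : Measurable f), partitionEntropy μ T f

/-- The topological pressure of `T` for the potential `φ`: the supremum of `h_ν(T) + ∫ φ dν` over
all `T`-invariant probability measures `ν`. -/
def pressure {X : Type*} [MeasurableSpace X] (T : X → X) (φ : X → ℝ) : EReal :=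
  ⨆ (ν : Measure X) (_ : IsProbabilityMeasure ν) (_ : MeasurePreserving T ν ν),
    measureEntropy ν T + ((∫ x, φ x ∂ν : ℝ) : EReal)

/-- `φ'` is co-homologous to `φ`: `φ' = φ + χ - χ ∘ T` for some continuous `χ`. -/
def Cohomologous {X : Type*} [TopologicalSpace X] (T : X → X) (φ φ' : X → ℝ) : Prop :=
  ∃ χ : X → ℝ, Continuous χ ∧ ∀ x, φ' x = φ x + χ x - χ (T x)

/-- The oscillation `sup φ - inf φ` (used for bounded functions on a nonempty space). -/
def oscillation {X : Type*} (φ : X → ℝ) : ℝ :=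
  (⨆ x, φ x) - ⨅ x, φ x

/-- The bounded range condition `sup φ - inf φ < h_top(T)`. -/
def BoundedRange {X : Type*} [UniformSpace X] (T : X → X) (φ : X → ℝ) : Prop :=
  ((oscillation φ : ℝ) : EReal) < topEntropy T

/-- `φ` is hyperbolic for `T`: for some `n ≥ 1` the Birkhoff averages satisfy
`sup (1/n) S_n(φ) < P(T, φ)`. -/
def IsHyperbolic {X : Type*} [MeasurableSpace X] (T : X → X) (φ : X → ℝ) : Prop :=
  ∃ n : ℕ, 1 ≤ n ∧ ((⨆ x, birkhoffAverage ℝ T φ n x : ℝ) : EReal) < pressure T φ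

end ThermoFormalism

end

/-!
The substance of the theorem is the lower bound in the variational principle: for every real
`a < h_top(T)` there is an invariant probability measure `ν` with `a ≤ h_ν(T)`
(`exists_measureEntropy_ge`). The argument is Misiurewicz's. For infinitely many `n` there is an
`(n, ε)`-separated set `E_n` with at least `exp (n a)` points (`exists_frequently_separated`). Let
`σ_n` be its normalized counting measure, `μ_n` the average of the first `n` push-forwards of
`σ_n`, and `ν` a limit of the `μ_n` along an ultrafilter, which exists by compactness of the space
of probability measures. A partition with cells of diameter less than `ε` and `ν`-null boundaries
(`exists_partition_null_frontier`) separates the points of `E_n` by their itineraries of length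
`n`, so the itinerary entropy under `σ_n` is at least `n a`. Cutting the itinerary into blocks of
length `q` and using subadditivity and concavity of the Shannon entropy gives
`q n a ≤ n H_{μ_n}(q) + O(1)` (`mul_shannonEntropy_itinerary_le`), and letting `n → ∞` yields
`q a ≤ H_ν(q)` for all `q`.

Applied to `T` on `X'`, this gives an invariant measure of positive entropy carried by `X'`, where
`φ` vanishes; since `φ ≤ 0`, the pressure exceeds `sup φ`. Applied to `T` on `X`, together with
`∫ ψ dν ≥ inf ψ`, it handles the bounded range condition.

The oscillation bound compares Birkhoff averages: those of co-homologous functions differ by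
`O(1/n)`, so `sup φ' ≥ 0` because of `X'` and `inf φ' ≤ sup_{X''} φ` because of `X''`. For the last
assertion, take a continuous function that is `0` on `X'`, `-h_top(T)` on `X''` and in between
elsewhere: every co-homologous function has oscillation at least `h_top(T)`.
-/

namespace ThermoFormalism

open scoped Topology Uniformity

/-! ### Shannon entropy of finite partitions -/

section Shannon

variable {X : Type*} [MeasurableSpace X] {ι κ : Type*} [Fintype ι] [Fintype κ]

lemma sum_measureReal_inter_preimage [MeasurableSpace κ] [MeasurableSingletonClass κ]
    (μ : Measure X) [IsFiniteMeasure μ] (s : Set X) {g : X → κ} (hg : Measurable g) :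
    ∑ j, μ.real (s ∩ g ⁻¹' {j}) = μ.real s := by
  have h := sum_measureReal_preimage_singleton (μ := μ.restrict s) (f := g) Finset.univ
    (fun y _ => hg (measurableSet_singleton y))
  simp only [Finset.coe_univ, preimage_univ] at h
  rw [measureReal_restrict_apply MeasurableSet.univ, univ_inter] at h
  rw [← h]
  refine Finset.sum_congr rfl fun j _ => ?_
  rw [measureReal_restrict_apply (hg (measurableSet_singleton j)), inter_comm]

lemma shannonEntropy_nonneg (μ : Measure X) [IsProbabilityMeasure μ] (f : X → ι) :
    0 ≤ shannonEntropy μ f :=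
  Finset.sum_nonneg fun _ _ => Real.negMulLog_nonneg measureReal_nonneg measureReal_le_one

/-- A crude bound, sufficient because it only enters through error terms that are divided by the
length of an orbit. -/
lemma shannonEntropy_le_card (μ : Measure X) [IsProbabilityMeasure μ] (f : X → ι) :
    shannonEntropy μ f ≤ Fintype.card ι := by
  have h : ∀ i ∈ Finset.univ, Real.negMulLog (μ.real (f ⁻¹' {i})) ≤ 1 := fun i _ =>
    (Real.negMulLog_le_one_sub_self measureReal_nonneg).trans (by simp)
  simpa [shannonEntropy] using Finset.sum_le_sum h

lemma shannonEntropy_equiv_comp (μ : Measure X) (e : ι ≃ κ) (f : X → ι) :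
    shannonEntropy μ (fun x => e (f x)) = shannonEntropy μ f := by
  unfold shannonEntropy
  rw [← e.sum_comp]
  refine Finset.sum_congr rfl fun i _ => ?_
  congr 2
  ext x
  simp

lemma shannonEntropy_map {Y : Type*} [MeasurableSpace Y] [MeasurableSpace ι]
    [MeasurableSingletonClass ι] (μ : Measure X) {g : X → Y} (hg : Measurable g)
    {f : Y → ι} (hf : Measurable f) :
    shannonEntropy (μ.map g) f = shannonEntropy μ (fun x => f (g x)) := by
  unfold shannonEntropy
  refine Finset.sum_congr rfl fun i _ => ?_
  rw [map_measureReal_apply hg (hf (measurableSet_singleton i))]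
  rfl

/-- Subadditivity of the Shannon entropy under joins. With `p`, `q` the marginals of the joint
distribution `r`, it is the inequality `∑ r log (r / (p q)) ≥ ∑ (r - p q) = 0`. -/
lemma shannonEntropy_prodMk_le [MeasurableSpace ι] [MeasurableSingletonClass ι]
    [MeasurableSpace κ] [MeasurableSingletonClass κ] (μ : Measure X) [IsProbabilityMeasure μ]
    {f : X → ι} {g : X → κ} (hf : Measurable f) (hg : Measurable g) :
    shannonEntropy μ (fun x => (f x, g x)) ≤ shannonEntropy μ f + shannonEntropy μ g := by
  set p : ι → ℝ := fun i => μ.real (f ⁻¹' {i})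
  set q : κ → ℝ := fun j => μ.real (g ⁻¹' {j})
  set r : ι → κ → ℝ := fun i j => μ.real (f ⁻¹' {i} ∩ g ⁻¹' {j})
  have hp : ∀ i, ∑ j, r i j = p i := fun i => sum_measureReal_inter_preimage μ _ hg
  have hq : ∀ j, ∑ i, r i j = q j := fun j => by
    simp only [r, inter_comm _ (g ⁻¹' {j})]
    exact sum_measureReal_inter_preimage μ _ hf
  have hp1 : ∑ i, p i = 1 := by
    simpa using sum_measureReal_inter_preimage μ univ hf
  have hq1 : ∑ j, q j = 1 := by
    simpa using sum_measureReal_inter_preimage μ univ hg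
  have hr1 : ∑ i, ∑ j, r i j = 1 := by simp only [hp, hp1]
  have hjoint : shannonEntropy μ (fun x => (f x, g x)) = ∑ i, ∑ j, Real.negMulLog (r i j) := by
    unfold shannonEntropy
    rw [Fintype.sum_prod_type]
    refine Finset.sum_congr rfl fun i _ => Finset.sum_congr rfl fun j _ => ?_
    congr 2
    ext x
    simp
  have hf' : shannonEntropy μ f = ∑ i, ∑ j, -(r i j * Real.log (p i)) := by
    refine Finset.sum_congr rfl fun i _ => ?_
    rw [Finset.sum_neg_distrib, ← Finset.sum_mul, hp i, Real.negMulLog_eq_neg]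
  have hg' : shannonEntropy μ g = ∑ i, ∑ j, -(r i j * Real.log (q j)) := by
    rw [Finset.sum_comm]
    refine Finset.sum_congr rfl fun j _ => ?_
    rw [Finset.sum_neg_distrib, ← Finset.sum_mul, hq j, Real.negMulLog_eq_neg]
  have hterm : ∀ i j, Real.negMulLog (r i j) ≤
      -(r i j * Real.log (p i)) + -(r i j * Real.log (q j)) + (p i * q j - r i j) := by
    intro i j
    have hr0 : 0 ≤ r i j := measureReal_nonneg
    rcases hr0.eq_or_lt with h0 | h0
    · rw [← h0]
      simpa using mul_nonneg (measureReal_nonneg (μ := μ)) (measureReal_nonneg (μ := μ))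
    · have hpi : 0 < p i := h0.trans_le (measureReal_mono inter_subset_left)
      have hqj : 0 < q j := h0.trans_le (measureReal_mono inter_subset_right)
      have hlog := Real.log_le_sub_one_of_pos (div_pos (mul_pos hpi hqj) h0)
      rw [Real.log_div (mul_pos hpi hqj).ne' h0.ne', Real.log_mul hpi.ne' hqj.ne'] at hlog
      have := mul_le_mul_of_nonneg_left hlog h0.le
      rw [mul_sub (r i j) (p i * q j / r i j), mul_div_cancel₀ _ h0.ne'] at this
      rw [Real.negMulLog]
      linarith
  have hsum := Finset.sum_le_sum fun i (_ : i ∈ Finset.univ) =>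
    Finset.sum_le_sum fun j (_ : j ∈ Finset.univ) => hterm i j
  simp only [Finset.sum_add_distrib, Finset.sum_sub_distrib, ← Finset.mul_sum, hq1, mul_one, hp1,
    hr1, sub_self, add_zero] at hsum
  rw [hjoint, hf', hg']
  exact hsum

/-- Concavity of the Shannon entropy: averaging distributions does not decrease the mean
entropy. -/
lemma sum_shannonEntropy_le_of_average {n : ℕ} (hn : 0 < n) (μ : ℕ → Measure X) (ν : Measure X)
    (f : X → ι)
    (h : ∀ i, ν.real (f ⁻¹' {i}) = ∑ p ∈ Finset.range n, (n : ℝ)⁻¹ * (μ p).real (f ⁻¹' {i})) :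
    ∑ p ∈ Finset.range n, shannonEntropy (μ p) f ≤ n * shannonEntropy ν f := by
  have hn' : (0 : ℝ) < n := by exact_mod_cast hn
  unfold shannonEntropy
  rw [Finset.sum_comm, Finset.mul_sum]
  refine Finset.sum_le_sum fun i _ => ?_
  have hJ := Real.concaveOn_negMulLog.le_map_sum (t := Finset.range n)
    (w := fun _ => (n : ℝ)⁻¹) (p := fun p => (μ p).real (f ⁻¹' {i})) (fun _ _ => by positivity)
    (by simp [hn'.ne']) (fun _ _ => measureReal_nonneg)
  simp only [smul_eq_mul] at hJ
  rw [← h i, ← Finset.mul_sum] at hJ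
  rwa [inv_mul_le_iff₀ hn'] at hJ

/-- If the partition separates the points of a finite set, the normalized counting measure of the
set has the largest possible entropy. -/
lemma log_card_le_shannonEntropy_uniformOn [MeasurableSingletonClass X] (E : Finset X)
    (f : X → ι) (hf : InjOn f E) :
    Real.log E.card ≤ shannonEntropy (ProbabilityTheory.uniformOn (E : Set X)) f := by
  classical
  rcases E.eq_empty_or_nonempty with rfl | hE
  · simp [shannonEntropy, ProbabilityTheory.uniformOn_empty_meas]
  have := ProbabilityTheory.isProbabilityMeasure_uniformOn E.finite_toSet hE
  have hcard : (0 : ℝ) < E.card := by exact_mod_cast hE.card_pos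
  have hreal : ∀ e ∈ E, (ProbabilityTheory.uniformOn (E : Set X)).real (f ⁻¹' {f e})
      = (E.card : ℝ)⁻¹ := by
    intro e he
    have hset : (E : Set X) ∩ f ⁻¹' {f e} = {e} := by
      ext x
      constructor
      · rintro ⟨hx, hx'⟩
        exact hf hx he hx'
      · rintro rfl
        exact ⟨he, rfl⟩
    rw [Measure.real, ← ProbabilityTheory.uniformOn_inter_self E.finite_toSet, hset,
      ← Finset.coe_singleton, ProbabilityTheory.uniformOn_apply_finset,
      Finset.inter_singleton_of_mem he]
    simp
  calc Real.log E.card = ∑ e ∈ E, Real.negMulLog (E.card : ℝ)⁻¹ := by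
        rw [Finset.sum_const, nsmul_eq_mul, Real.negMulLog, Real.log_inv]
        field_simp
    _ = ∑ e ∈ E, Real.negMulLog
          ((ProbabilityTheory.uniformOn (E : Set X)).real (f ⁻¹' {f e})) :=
        Finset.sum_congr rfl fun e he => by rw [hreal e he]
    _ = ∑ i ∈ E.image f, Real.negMulLog
          ((ProbabilityTheory.uniformOn (E : Set X)).real (f ⁻¹' {i})) := by
        rw [Finset.sum_image hf]
    _ ≤ _ := Finset.sum_le_sum_of_subset_of_nonneg (Finset.subset_univ _) fun _ _ _ =>
        Real.negMulLog_nonneg measureReal_nonneg measureReal_le_one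

end Shannon

/-! ### Splitting a long orbit into blocks -/

/-- If `F p m` is a subadditive cost of the time window `[p, p + m)`, growing at most linearly,
then the cost of `[0, n)` is, up to a bounded error, at most the mean over the `q` residues
modulo `q` of the total cost of the windows of length `q` that start at this residue. -/
lemma mul_le_sum_add_of_subadditive (F : ℕ → ℕ → ℝ) (L : ℝ) (hF0 : ∀ p m, 0 ≤ F p m)
    (hadd : ∀ p m l, F p (m + l) ≤ F p m + F (p + m) l) (hL : ∀ p m, F p m ≤ m * L)
    (q n : ℕ) (hqn : q ≤ n) :
    q * F 0 n ≤ ∑ i ∈ Finset.range n, F i q + 2 * q ^ 2 * L := by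
  rcases Nat.eq_zero_or_pos q with rfl | hq
  · simpa using Finset.sum_nonneg fun i (_ : i ∈ Finset.range n) => hF0 i 0
  have hL0 : 0 ≤ L := by simpa using (hF0 0 1).trans (hL 0 1)
  have hblocks : ∀ p a, F p (a * q) ≤ ∑ r ∈ Finset.range a, F (p + r * q) q := by
    intro p a
    induction a with
    | zero => simpa using hL p 0
    | succ a ih =>
      rw [Finset.sum_range_succ, Nat.succ_mul]
      exact (hadd p (a * q) q).trans (by linarith)
  -- One block fewer than fit into `[0, n)`, so that the blocks fit after any shift by `j < q`.
  obtain ⟨a, b, hb, hab⟩ : ∃ a b, b < q ∧ n = (a + 1) * q + b := by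
    refine ⟨n / q - 1, n % q, Nat.mod_lt _ hq, ?_⟩
    rw [Nat.sub_add_cancel (Nat.div_pos hqn hq), mul_comm]
    exact (Nat.div_add_mod n q).symm
  have hshift : ∀ j ∈ Finset.range q,
      F 0 n ≤ ∑ r ∈ Finset.range a, F (j + r * q) q + 2 * q * L := by
    intro j hj
    rw [Finset.mem_range] at hj
    have hn : n = j + (a * q + (q + b - j)) := by rw [hab, add_mul]; omega
    have h1 := hadd 0 j (a * q + (q + b - j))
    have h2 := hadd (0 + j) (a * q) (q + b - j)
    rw [← hn] at h1
    rw [zero_add] at h1 h2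
    have h3 := hblocks j a
    have h4 := hL 0 j
    have h5 := hL (j + a * q) (q + b - j)
    have h6 : (j : ℝ) * L + ((q + b - j : ℕ) : ℝ) * L ≤ 2 * q * L := by
      rw [← add_mul]
      refine mul_le_mul_of_nonneg_right ?_ hL0
      have : j + (q + b - j) ≤ 2 * q := by omega
      exact_mod_cast this
    linarith
  have hre : ∀ a, ∑ j ∈ Finset.range q, ∑ r ∈ Finset.range a, F (j + r * q) q
      = ∑ i ∈ Finset.range (a * q), F i q := by
    intro a
    induction a with
    | zero => simp
    | succ a ih =>
      simp only [Finset.sum_range_succ, Finset.sum_add_distrib, ih]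
      rw [Nat.succ_mul, Finset.sum_range_add]
      simp only [add_comm]
  have hsum := Finset.sum_le_sum hshift
  rw [Finset.sum_add_distrib, hre a] at hsum
  simp only [Finset.sum_const, Finset.card_range, nsmul_eq_mul] at hsum
  have hle : ∑ i ∈ Finset.range (a * q), F i q ≤ ∑ i ∈ Finset.range n, F i q :=
    Finset.sum_le_sum_of_subset_of_nonneg
      (Finset.range_subset_range.2 (by rw [hab, add_mul]; omega)) fun i _ _ => hF0 i q
  nlinarith

/-! ### Itineraries -/

section Itinerary

variable {X ι : Type*}

lemma itinerary_add (T : X → X) (f : X → ι) (m l : ℕ) (x : X) :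
    itinerary T f (m + l) x =
      Fin.appendEquiv m l (itinerary T f m x, itinerary T f l (T^[m] x)) := by
  refine funext fun j => ?_
  refine Fin.addCases (fun i => ?_) (fun i => ?_) j
  · simp [itinerary]
  · simp [itinerary, ← Function.iterate_add_apply, add_comm]

variable [MeasurableSpace X] [MeasurableSpace ι]

lemma measurable_itinerary {T : X → X} (hT : Measurable T) {f : X → ι} (hf : Measurable f)
    (n : ℕ) : Measurable (itinerary T f n) :=
  measurable_pi_lambda _ fun _ => hf.comp (hT.iterate _)

variable [Fintype ι] [MeasurableSingletonClass ι]

lemma shannonEntropy_itinerary_window_add_le (μ : Measure X) [IsProbabilityMeasure μ]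
    {T : X → X} (hT : Measurable T) {f : X → ι} (hf : Measurable f) (p m l : ℕ) :
    shannonEntropy μ (fun x => itinerary T f (m + l) (T^[p] x)) ≤
      shannonEntropy μ (fun x => itinerary T f m (T^[p] x)) +
        shannonEntropy μ (fun x => itinerary T f l (T^[p + m] x)) := by
  simp only [itinerary_add]
  rw [shannonEntropy_equiv_comp]
  simp only [← Function.iterate_add_apply, add_comm m p]
  exact shannonEntropy_prodMk_le μ ((measurable_itinerary hT hf m).comp (hT.iterate p))
    ((measurable_itinerary hT hf l).comp (hT.iterate (p + m)))

lemma shannonEntropy_itinerary_window_le (μ : Measure X) [IsProbabilityMeasure μ]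
    {T : X → X} (hT : Measurable T) {f : X → ι} (hf : Measurable f) (p m : ℕ) :
    shannonEntropy μ (fun x => itinerary T f m (T^[p] x)) ≤ m * (Fintype.card ι : ℝ) := by
  induction m with
  | zero =>
    have h : ∀ i : Fin 0 → ι, (fun x => itinerary T f 0 (T^[p] x)) ⁻¹' {i} = univ := fun i => by
      ext x
      simp [eq_iff_true_of_subsingleton]
    simp [shannonEntropy, h]
  | succ m ih =>
    have h1 := shannonEntropy_itinerary_window_add_le μ hT hf p m 1
    have h2 : shannonEntropy μ (fun x => itinerary T f 1 (T^[p + m] x)) ≤ Fintype.card ι := by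
      have := shannonEntropy_le_card μ (fun x => f (T^[p + m] x))
      rw [← shannonEntropy_equiv_comp μ (Equiv.funUnique (Fin 1) ι)]
      exact this
    push_cast
    linarith

end Itinerary

/-! ### Orbit averages of a measure -/

section OrbitAverage

variable {X : Type*} [MeasurableSpace X]

/-- The average `(1/n) ∑_{p < n} (T^p)_* σ` of the first `n` push-forwards of `σ` under `T`. -/
noncomputable def orbitAverage (T : X → X) (σ : Measure X) (n : ℕ) : Measure X :=
  (n : ENNReal)⁻¹ • ∑ p ∈ Finset.range n, σ.map T^[p]

lemma isProbabilityMeasure_orbitAverage {T : X → X} (hT : Measurable T)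
    (σ : Measure X) [IsProbabilityMeasure σ] {n : ℕ} (hn : 0 < n) :
    IsProbabilityMeasure (orbitAverage T σ n) := by
  constructor
  have h : ∀ p ∈ Finset.range n, (σ.map T^[p]) univ = 1 := fun p _ => by
    rw [Measure.map_apply (hT.iterate p) MeasurableSet.univ, preimage_univ, measure_univ]
  rw [orbitAverage, Measure.smul_apply, Measure.finsetSum_apply, Finset.sum_congr rfl h]
  simp only [Finset.sum_const, Finset.card_range, nsmul_eq_mul, mul_one, smul_eq_mul]
  exact ENNReal.inv_mul_cancel (by exact_mod_cast hn.ne') (ENNReal.natCast_ne_top n)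

lemma orbitAverage_real {T : X → X} (hT : Measurable T)
    (σ : Measure X) [IsProbabilityMeasure σ] (n : ℕ) (s : Set X) :
    (orbitAverage T σ n).real s = ∑ p ∈ Finset.range n, (n : ℝ)⁻¹ * (σ.map T^[p]).real s := by
  have (p : ℕ) : IsProbabilityMeasure (σ.map T^[p]) :=
    Measure.isProbabilityMeasure_map (hT.iterate p).aemeasurable
  rw [← Finset.mul_sum, orbitAverage, measureReal_ennreal_smul_apply, Measure.real,
    Measure.finsetSum_apply, ENNReal.toReal_sum fun _ _ => measure_ne_top _ _]
  simp [Measure.real]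

lemma integral_orbitAverage {T : X → X} (hT : Measurable T)
    (σ : Measure X) [IsProbabilityMeasure σ] (n : ℕ) {g : X → ℝ} (hg : Measurable g) {C : ℝ}
    (hC : ∀ x, |g x| ≤ C) :
    ∫ x, g x ∂(orbitAverage T σ n) = (n : ℝ)⁻¹ * ∑ p ∈ Finset.range n, ∫ x, g (T^[p] x) ∂σ := by
  have (p : ℕ) : IsProbabilityMeasure (σ.map T^[p]) :=
    Measure.isProbabilityMeasure_map (hT.iterate p).aemeasurable
  rw [orbitAverage, integral_smul_measure, integral_finsetSum_measure fun p _ =>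
    Integrable.of_bound hg.aestronglyMeasurable C (Eventually.of_forall hC)]
  simp [integral_map (hT.iterate _).aemeasurable hg.aestronglyMeasurable]

/-- The orbit average of length `n` is invariant up to an error of order `1/n`, by telescoping. -/
lemma abs_integral_comp_orbitAverage_sub_le {T : X → X} (hT : Measurable T)
    (σ : Measure X) [IsProbabilityMeasure σ] (n : ℕ) {g : X → ℝ} (hg : Measurable g) {C : ℝ}
    (hC : ∀ x, |g x| ≤ C) :
    |∫ x, g (T x) ∂(orbitAverage T σ n) - ∫ x, g x ∂(orbitAverage T σ n)| ≤
      (n : ℝ)⁻¹ * (2 * C) := by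
  rw [integral_orbitAverage hT σ n (g := fun x => g (T x)) (hg.comp hT) fun x => hC (T x),
    integral_orbitAverage hT σ n hg hC, ← mul_sub, ← Finset.sum_sub_distrib]
  simp only [← Function.iterate_succ_apply' T]
  rw [Finset.sum_range_sub fun p => ∫ x, g (T^[p] x) ∂σ, abs_mul, abs_of_nonneg (by positivity)]
  have hb (p : ℕ) : |∫ x, g (T^[p] x) ∂σ| ≤ C := by
    simpa using norm_integral_le_of_norm_le_const (μ := σ) (f := fun x => g (T^[p] x))
      (Eventually.of_forall fun x => hC _)
  refine mul_le_mul_of_nonneg_left ?_ (by positivity)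
  exact (abs_sub _ _).trans (by linarith [hb n, hb 0])

/-- The key estimate: up to an error of order `1/n`, the entropy per unit time of the itineraries of
length `n` under `σ` is at most that of the itineraries of length `q` under the orbit average of
`σ`. -/
lemma mul_shannonEntropy_itinerary_le {T : X → X} (hT : Measurable T)
    (σ : Measure X) [IsProbabilityMeasure σ] {ι : Type*} [Fintype ι] [MeasurableSpace ι]
    [MeasurableSingletonClass ι] {f : X → ι} (hf : Measurable f) {q n : ℕ} (hn : 0 < n)
    (hqn : q ≤ n) :
    q * shannonEntropy σ (itinerary T f n) ≤
      n * shannonEntropy (orbitAverage T σ n) (itinerary T f q) +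
        2 * q ^ 2 * Fintype.card ι := by
  have h1 := mul_le_sum_add_of_subadditive
    (fun p m => shannonEntropy σ (fun x => itinerary T f m (T^[p] x))) (Fintype.card ι)
    (fun _ _ => shannonEntropy_nonneg σ _)
    (shannonEntropy_itinerary_window_add_le σ hT hf)
    (shannonEntropy_itinerary_window_le σ hT hf) q n hqn
  have h2 := sum_shannonEntropy_le_of_average hn (fun p => σ.map T^[p]) (orbitAverage T σ n)
    (itinerary T f q) (fun i => orbitAverage_real hT σ n _)
  simp only [shannonEntropy_map σ (hT.iterate _) (measurable_itinerary hT hf q)] at h2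
  simp only [Function.iterate_zero_apply] at h1
  exact h1.trans (by linarith)

end OrbitAverage

/-! ### Partitions with null boundary -/

lemma frontier_iInter_subset_of_finite {X ι : Type*} [TopologicalSpace X] [Finite ι]
    (A : ι → Set X) : frontier (⋂ i, A i) ⊆ ⋃ i, frontier (A i) := by
  rintro x ⟨hx, hx'⟩
  rw [interior_iInter_of_finite, mem_iInter, not_forall] at hx'
  obtain ⟨i, hi⟩ := hx'
  exact mem_iUnion.2 ⟨i, closure_mono (iInter_subset _ i) hx, hi⟩

/-- Given a finite measure on a compact metric space, there are finite measurable partitions into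
cells of small diameter whose boundaries are null sets. The cells are the atoms of the algebra
generated by a finite cover by balls whose radii are chosen with null spheres. -/
lemma exists_partition_null_frontier {X : Type*} [MetricSpace X] [CompactSpace X]
    [MeasurableSpace X] [BorelSpace X] (μ : Measure X) [IsFiniteMeasure μ] {ε : ℝ} (hε : 0 < ε) :
    ∃ (k : ℕ) (f : X → Fin k), Measurable f ∧ (∀ i, μ (frontier (f ⁻¹' {i})) = 0) ∧
      ∀ x y, f x = f y → dist x y < ε := by
  classical
  choose r hr hr0 using fun x : X => exists_null_frontier_thickening μ {x} (half_pos hε)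
  simp only [Metric.thickening_singleton] at hr0
  obtain ⟨t, ht⟩ := isCompact_univ.elim_finite_subcover (fun x => Metric.ball x (r x))
    (fun _ => Metric.isOpen_ball)
    fun x _ => mem_iUnion.2 ⟨x, Metric.mem_ball_self (hr x).1⟩
  let g : X → t → Bool := fun x c => decide (x ∈ Metric.ball c.1 (r c))
  have hball : ∀ (c : t) (b : Bool), {x | g x c = b} = Metric.ball c.1 (r c) ∨
      {x | g x c = b} = (Metric.ball c.1 (r c))ᶜ := by
    rintro c (_ | _)
    · right; ext x; simp [g]
    · left; ext x; simp [g]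
  have hg : Measurable g := measurable_pi_lambda _ fun c => measurable_to_countable' fun b => by
    change MeasurableSet {x | g x c = b}
    rcases hball c b with h | h
    · exact h ▸ Metric.isOpen_ball.measurableSet
    · exact h ▸ Metric.isOpen_ball.measurableSet.compl
  have hcell : ∀ b : t → Bool, μ (frontier (g ⁻¹' {b})) = 0 := by
    intro b
    have hset : g ⁻¹' {b} = ⋂ c, {x | g x c = b c} := by
      ext x
      simp only [mem_preimage, mem_singleton_iff, funext_iff, mem_iInter, mem_ofPred_eq]
    rw [hset]
    refine measure_mono_null (frontier_iInter_subset_of_finite _) (measure_iUnion_null fun c => ?_)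
    rcases hball c (b c) with h | h
    · rw [h]; exact hr0 c
    · rw [h, frontier_compl]; exact hr0 c
  let e := Fintype.equivFin (t → Bool)
  refine ⟨_, fun x => e (g x), (measurable_of_finite e).comp hg, fun i => ?_, fun x y hxy => ?_⟩
  · have hset : (fun x => e (g x)) ⁻¹' {i} = g ⁻¹' {e.symm i} := by
      ext x
      simp [Equiv.eq_symm_apply]
    rw [hset]
    exact hcell _
  · obtain ⟨c, hc, hxc⟩ := mem_iUnion₂.1 (ht (mem_univ x))
    have hgc : g x ⟨c, hc⟩ = g y ⟨c, hc⟩ := congrFun (e.injective hxy) _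
    have hyc : y ∈ Metric.ball c (r c) := by
      simpa [g, Metric.mem_ball.1 hxc] using hgc
    have h1 := Metric.mem_ball.1 hxc
    have h2 := Metric.mem_ball.1 hyc
    have h3 := (hr c).2
    linarith [dist_triangle_right x y c]

/-- The cells of the refined partitions inherit null boundaries. -/
lemma measure_frontier_itinerary {X ι : Type*} [TopologicalSpace X] [MeasurableSpace X]
    [BorelSpace X] {μ : Measure X} {T : X → X} (hT : Continuous T) (hμ : MeasurePreserving T μ μ)
    {f : X → ι} (hf : ∀ i, μ (frontier (f ⁻¹' {i})) = 0) (n : ℕ) (c : Fin n → ι) :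
    μ (frontier (itinerary T f n ⁻¹' {c})) = 0 := by
  have hset : itinerary T f n ⁻¹' {c} = ⋂ j : Fin n, T^[j] ⁻¹' (f ⁻¹' {c j}) := by
    ext x
    simp [itinerary, funext_iff]
  rw [hset]
  refine measure_mono_null (frontier_iInter_subset_of_finite _) (measure_iUnion_null fun j => ?_)
  refine measure_mono_null ((hT.iterate j).frontier_preimage_subset _) ?_
  rw [(hμ.iterate j).measure_preimage isClosed_frontier.measurableSet.nullMeasurableSet]
  exact hf _

/-! ### The variational principle: lower bound -/

/-- Separated sets realizing an exponential growth rate below the topological entropy. -/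
lemma exists_frequently_separated {X : Type*} [MetricSpace X] {T : X → X} {a : ℝ}
    (ha : (a : EReal) < topEntropy T) :
    ∃ ε > 0, ∃ᶠ n : ℕ in atTop, ∃ E : Finset X, E.Nonempty ∧ n * a ≤ Real.log E.card ∧
      ∀ x ∈ E, ∀ y ∈ E, (∀ k < n, dist (T^[k] x) (T^[k] y) < ε) → x = y := by
  rw [topEntropy, Dynamics.coverEntropy_eq_iSup_netEntropyEntourage] at ha
  simp only [lt_iSup_iff] at ha
  obtain ⟨U, hU, ha⟩ := ha
  obtain ⟨ε, hε, hεU⟩ := Metric.mem_uniformity_dist.1 hU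
  refine ⟨ε, hε, ?_⟩
  have hfreq := (frequently_lt_of_lt_limsup (by isBoundedDefault) ha).and_eventually
    (eventually_gt_atTop 0)
  refine hfreq.mono ?_
  rintro n ⟨hn, hn0⟩
  rw [EReal.lt_div_iff (by exact_mod_cast hn0) (EReal.natCast_ne_top n),
    ← EReal.coe_natCast, ← EReal.coe_mul, ← EReal.log_exp ((a * n : ℝ) : EReal),
    ENNReal.log_lt_log_iff, EReal.exp_coe] at hn
  have hnat : ((⌊Real.exp (a * n)⌋₊ : ℕ) : ℕ∞) < Dynamics.netMaxcard T univ U n := by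
    rw [← ENat.toENNReal_lt]
    refine lt_of_le_of_lt ?_ hn
    rw [ENat.toENNReal_coe, ← ENNReal.ofReal_natCast]
    exact ENNReal.ofReal_le_ofReal (Nat.floor_le (Real.exp_nonneg _))
  simp only [Dynamics.netMaxcard, lt_iSup_iff] at hnat
  obtain ⟨E, hEnet, hEcard⟩ := hnat
  replace hEcard : Real.exp (a * n) < E.card :=
    (Nat.floor_lt (Real.exp_nonneg _)).1 (by exact_mod_cast hEcard)
  have hEpos : (0 : ℝ) < E.card := (Real.exp_pos _).trans hEcard
  refine ⟨E, Finset.card_pos.1 (by exact_mod_cast hEpos), ?_, fun x hx y hy hxy => ?_⟩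
  · rw [mul_comm, Real.le_log_iff_exp_le hEpos]
    exact hEcard.le
  · refine hEnet.2.elim_set hx hy y ?_ ?_
    · exact Dynamics.mem_ball_dynEntourage.2 fun k hk => hεU (hxy k hk)
    · exact Dynamics.mem_ball_dynEntourage.2 fun k _ => refl_mem_uniformity hU

/-- The orbit averages along separated sets have an invariant limit measure. Its entropy is
bounded below through a partition with null boundary, on whose refinements the masses pass to the
limit. -/
theorem exists_measureEntropy_ge {X : Type*} [MetricSpace X] [CompactSpace X] [MeasurableSpace X]
    [BorelSpace X] {T : X → X} (hT : Continuous T) {a : ℝ} (ha : (a : EReal) < topEntropy T) :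
    ∃ ν : Measure X, IsProbabilityMeasure ν ∧ MeasurePreserving T ν ν ∧
      (a : EReal) ≤ measureEntropy ν T := by
  obtain ⟨ε, hε, hfreq⟩ := exists_frequently_separated ha
  have hTm := hT.measurable
  obtain ⟨N, hN, hNE⟩ :=
    extraction_of_frequently_atTop (hfreq.and_eventually (eventually_gt_atTop 0))
  choose E hE using fun m => (hNE m).1
  let σ : ℕ → Measure X := fun m => ProbabilityTheory.uniformOn (E m : Set X)
  have hσ : ∀ m, IsProbabilityMeasure (σ m) := fun m =>
    ProbabilityTheory.isProbabilityMeasure_uniformOn (E m).finite_toSet (hE m).1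
  let μ : ℕ → ProbabilityMeasure X := fun m =>
    ⟨orbitAverage T (σ m) (N m), isProbabilityMeasure_orbitAverage hTm (σ m) (hNE m).2⟩
  -- By compactness the averages converge along an ultrafilter finer than `atTop`.
  let G : Ultrafilter ℕ := Ultrafilter.of atTop
  have hG : (G : Filter ℕ) ≤ atTop := Ultrafilter.of_le atTop
  obtain ⟨ν, -, hν⟩ := isCompact_univ.ultrafilter_le_nhds (G.map μ) (by simp)
  replace hν : Tendsto μ G (𝓝 ν) := hν
  have hNinv : Tendsto (fun m => ((N m : ℕ) : ℝ)⁻¹) G (𝓝 0) :=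
    (tendsto_inv_atTop_zero.comp (tendsto_natCast_atTop_atTop.comp hN.tendsto_atTop)).mono_left hG
  have hinv : MeasurePreserving T (ν : Measure X) ν := by
    refine ⟨hTm, ?_⟩
    have : IsProbabilityMeasure ((ν : Measure X).map T) :=
      Measure.isProbabilityMeasure_map hTm.aemeasurable
    refine ext_of_forall_integral_eq_of_IsFiniteMeasure fun g => ?_
    rw [integral_map hTm.aemeasurable g.continuous.aestronglyMeasurable]
    have h1 := (ProbabilityMeasure.tendsto_iff_forall_integral_tendsto.1 hν) g
    have h2 := (ProbabilityMeasure.tendsto_iff_forall_integral_tendsto.1 hν)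
      (g.compContinuous ⟨T, hT⟩)
    have h3 : Tendsto (fun m => ((N m : ℕ) : ℝ)⁻¹ * (2 * ‖g‖)) G (𝓝 0) := by
      simpa using hNinv.mul_const (2 * ‖g‖)
    refine sub_eq_zero.1 (tendsto_nhds_unique (h2.sub h1) ?_)
    exact squeeze_zero_norm (fun m => abs_integral_comp_orbitAverage_sub_le hTm (σ m) (N m)
      g.continuous.measurable fun x => g.norm_coe_le_norm x) h3
  refine ⟨ν, inferInstance, hinv, ?_⟩
  obtain ⟨k, f, hf, hf0, hfε⟩ := exists_partition_null_frontier (ν : Measure X) hε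
  refine le_trans ?_ (le_iSup₂_of_le k f (le_iSup_of_le hf le_rfl))
  have hcell : ∀ q (c : Fin q → Fin k), Tendsto (fun m => (μ m : Measure X).real
      (itinerary T f q ⁻¹' {c})) G (𝓝 ((ν : Measure X).real (itinerary T f q ⁻¹' {c}))) :=
    fun q c => (ENNReal.tendsto_toReal (measure_ne_top _ _)).comp
      (ProbabilityMeasure.tendsto_measure_of_null_frontier_of_tendsto' hν
        (measure_frontier_itinerary hT hinv hf0 q c))
  have hlim : ∀ q, Tendsto (fun m => shannonEntropy (μ m : Measure X) (itinerary T f q)) G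
      (𝓝 (shannonEntropy (ν : Measure X) (itinerary T f q))) := fun q =>
    tendsto_finsetSum _ fun c _ => (Real.continuous_negMulLog.tendsto _).comp (hcell q c)
  have hbound : ∀ q : ℕ, q * a ≤ shannonEntropy (ν : Measure X) (itinerary T f q) := by
    intro q
    have hlim' := (hlim q).add (hNinv.const_mul (2 * (q : ℝ) ^ 2 * Fintype.card (Fin k)))
    rw [mul_zero, add_zero] at hlim'
    refine ge_of_tendsto hlim' ?_
    filter_upwards [hG (hN.tendsto_atTop.eventually_ge_atTop q)] with m hm
    have hinj : InjOn (itinerary T f (N m)) (E m) := fun x hx y hy hxy =>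
      (hE m).2.2 x hx y hy fun j hj => hfε _ _ (congrFun hxy ⟨j, hj⟩)
    have h1 := (hE m).2.1.trans (log_card_le_shannonEntropy_uniformOn (E m) _ hinj)
    have h2 := mul_shannonEntropy_itinerary_le hTm (σ m) hf (hNE m).2 hm
    have hN0 : (0 : ℝ) < N m := by exact_mod_cast (hNE m).2
    have h3 : (N m : ℝ) * (q * a) ≤ N m * shannonEntropy (orbitAverage T (σ m) (N m))
        (itinerary T f q) + 2 * q ^ 2 * Fintype.card (Fin k) := by
      refine le_trans ?_ h2
      rw [mul_left_comm]
      exact mul_le_mul_of_nonneg_left h1 (Nat.cast_nonneg q)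
    rw [← div_eq_mul_inv]
    change q * a ≤ shannonEntropy (orbitAverage T (σ m) (N m)) (itinerary T f q) + _
    rw [← mul_le_mul_iff_right₀ hN0, mul_add, mul_div_cancel₀ _ hN0.ne']
    exact h3
  refine le_limsup_of_frequently_le (Eventually.frequently ?_) (by isBoundedDefault)
  filter_upwards [eventually_gt_atTop 0] with q hq
  rw [EReal.coe_le_coe_iff, le_div_iff₀ (by exact_mod_cast hq), mul_comm]
  exact hbound q

/-! ### Measures and entropy on invariant subsets -/

/-- Every partition of the embedded system extends to the ambient system. -/
lemma measureEntropy_le_map {X Y : Type*} [MeasurableSpace X] [MeasurableSpace Y] {S : Y → Y}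
    {T : X → X} {i : Y → X} (hi : MeasurableEmbedding i) (hT : Measurable T)
    (hconj : Function.Semiconj i S T) (μ : Measure Y) [IsProbabilityMeasure μ] :
    measureEntropy μ S ≤ measureEntropy (μ.map i) T := by
  refine iSup_le fun k => iSup₂_le fun f hf => ?_
  have : Nonempty Y := μ.nonempty_of_neZero
  obtain ⟨f', hf', hext⟩ := hi.exists_measurable_extend hf fun _ => this.map f
  refine le_iSup₂_of_le k f' (le_iSup_of_le hf' (le_of_eq ?_))
  have hit : ∀ n, (fun y => itinerary T f' n (i y)) = itinerary S f n := fun n => by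
    funext y j
    change f' (T^[j] (i y)) = f (S^[j] y)
    rw [← hconj.iterate_right j y]
    exact congrFun hext _
  unfold partitionEntropy
  simp only [shannonEntropy_map μ hi.measurable (measurable_itinerary hT hf' _), hit]

lemma exists_measureEntropy_ge_of_mapsTo {X : Type*} [MetricSpace X] [MeasurableSpace X]
    [BorelSpace X] {T : X → X} {K : Set X} (hT : Continuous T) (hKc : IsCompact K)
    (hK : MapsTo T K K) {a : ℝ} (ha : (a : EReal) < topEntropy (hK.restrict T K K)) :
    ∃ ν : Measure X, IsProbabilityMeasure ν ∧ MeasurePreserving T ν ν ∧ (∀ᵐ x ∂ν, x ∈ K) ∧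
      (a : EReal) ≤ measureEntropy ν T := by
  have : CompactSpace K := isCompact_iff_compactSpace.1 hKc
  have hS : Continuous (hK.restrict T K K) := hT.restrict hK
  obtain ⟨μ, hμ, hμS, hμa⟩ := exists_measureEntropy_ge hS ha
  have hemb : MeasurableEmbedding (Subtype.val : K → X) :=
    MeasurableEmbedding.subtype_coe hKc.measurableSet
  have hconj : Function.Semiconj (Subtype.val : K → X) (hK.restrict T K K) T := fun _ => rfl
  refine ⟨μ.map Subtype.val, Measure.isProbabilityMeasure_map hemb.measurable.aemeasurable,
    ⟨hT.measurable, ?_⟩, ?_,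
    hμa.trans (measureEntropy_le_map hemb hT.measurable hconj μ)⟩
  · rw [Measure.map_map hT.measurable hemb.measurable]
    conv_rhs => rw [← hμS.map_eq, Measure.map_map hemb.measurable hS.measurable]
    rfl
  · rw [hemb.ae_map_iff]
    exact Eventually.of_forall fun x => x.2

/-! ### Pressure bounds -/

lemma measureEntropy_add_integral_le_pressure {X : Type*} [MeasurableSpace X]
    {T : X → X} (φ : X → ℝ) (ν : Measure X) [IsProbabilityMeasure ν]
    (hν : MeasurePreserving T ν ν) :
    measureEntropy ν T + ((∫ x, φ x ∂ν : ℝ) : EReal) ≤ pressure T φ :=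
  le_iSup₂_of_le ν inferInstance (le_iSup_of_le hν le_rfl)

lemma isHyperbolic_of_iSup_lt_pressure {X : Type*} [MeasurableSpace X] {T : X → X} {ψ : X → ℝ}
    (h : ((⨆ x, ψ x : ℝ) : EReal) < pressure T ψ) : IsHyperbolic T ψ :=
  ⟨1, le_rfl, by simpa only [birkhoffAverage_one] using h⟩

/-- An invariant measure of positive entropy carried by `K` has `∫ φ = 0`, so it alone makes the
pressure positive. -/
lemma iSup_lt_pressure_of_eq_zero_on {X : Type*} [MetricSpace X] [MeasurableSpace X] [BorelSpace X]
    {T : X → X} {K : Set X} (hT : Continuous T) (hKc : IsCompact K)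
    (hK : MapsTo T K K) (hent : 0 < topEntropy (hK.restrict T K K)) {φ : X → ℝ}
    (hφle : ∀ x, φ x ≤ 0) (hφK : ∀ x ∈ K, φ x = 0) :
    ((⨆ x, φ x : ℝ) : EReal) < pressure T φ := by
  obtain ⟨a, ha0, ha⟩ := EReal.lt_iff_exists_real_btwn.1 hent
  obtain ⟨ν, hν, hνT, hνK, hνa⟩ := exists_measureEntropy_ge_of_mapsTo hT hKc hK ha
  have hint : ∫ x, φ x ∂ν = 0 := integral_eq_zero_of_ae (hνK.mono fun x hx => hφK x hx)
  have hle := measureEntropy_add_integral_le_pressure φ ν hνT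
  rw [hint, EReal.coe_zero, add_zero] at hle
  calc ((⨆ x, φ x : ℝ) : EReal) ≤ 0 := by exact_mod_cast Real.iSup_nonpos hφle
    _ < a := ha0
    _ ≤ pressure T φ := hνa.trans hle

/-- The empty system has topological entropy `⊥`. -/
lemma nonempty_of_topEntropy_pos {X : Type*} [MetricSpace X] [MeasurableSpace X] [BorelSpace X]
    {T : X → X} {K : Set X} (hT : Continuous T) (hKc : IsCompact K)
    (hK : MapsTo T K K) (hent : 0 < topEntropy (hK.restrict T K K)) : K.Nonempty := by
  obtain ⟨ν, hν, -, hνK, -⟩ :=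
    exists_measureEntropy_ge_of_mapsTo (a := 0) hT hKc hK (by exact_mod_cast hent)
  exact hνK.exists

/-- A measure whose entropy exceeds `sup ψ - inf ψ` suffices, since its integral of `ψ` is at least
`inf ψ`. -/
lemma iSup_lt_pressure_of_boundedRange {X : Type*} [MetricSpace X] [CompactSpace X]
    [MeasurableSpace X] [BorelSpace X] {T : X → X} (hT : Continuous T) {ψ : X → ℝ}
    (hψ : Continuous ψ) (hbr : BoundedRange T ψ) : ((⨆ x, ψ x : ℝ) : EReal) < pressure T ψ := by
  obtain ⟨a, ha0, ha⟩ := EReal.lt_iff_exists_real_btwn.1 hbr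
  obtain ⟨ν, hν, hνT, hνa⟩ := exists_measureEntropy_ge hT ha
  rw [EReal.coe_lt_coe_iff, oscillation] at ha0
  have hinf : (⨅ x, ψ x) ≤ ∫ x, ψ x ∂ν := by
    have hint : Integrable ψ ν :=
      hψ.integrable_of_hasCompactSupport (HasCompactSupport.of_compactSpace ψ)
    have := integral_mono (integrable_const (⨅ x, ψ x)) hint
      fun x => ciInf_le (isCompact_range hψ).bddBelow x
    simpa using this
  calc ((⨆ x, ψ x : ℝ) : EReal) < ((a + ∫ x, ψ x ∂ν : ℝ) : EReal) := by
        rw [EReal.coe_lt_coe_iff]; linarith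
    _ = a + ((∫ x, ψ x ∂ν : ℝ) : EReal) := EReal.coe_add _ _
    _ ≤ measureEntropy ν T + ((∫ x, ψ x ∂ν : ℝ) : EReal) := by gcongr
    _ ≤ pressure T ψ := measureEntropy_add_integral_le_pressure ψ ν hνT

/-! ### Co-homologous functions -/

lemma birkhoffSum_eq_of_coboundary {X : Type*} {T : X → X} {φ φ' χ : X → ℝ}
    (h : ∀ x, φ' x = φ x + χ x - χ (T x)) (n : ℕ) (x : X) :
    birkhoffSum T φ' n x = birkhoffSum T φ n x + χ x - χ (T^[n] x) := by
  induction n with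
  | zero => simp
  | succ n ih =>
    rw [birkhoffSum_succ, birkhoffSum_succ, ih, h, Function.iterate_succ_apply']
    ring

/-- Birkhoff averages of co-homologous functions are asymptotically equal, so a lower bound on an
invariant set survives as a lower bound for the supremum. -/
lemma le_iSup_of_cohomologous {X : Type*} [TopologicalSpace X] [CompactSpace X] {T : X → X}
    {φ φ' : X → ℝ} (hφ' : Continuous φ') (hcoh : Cohomologous T φ φ') {K : Set X}
    (hK : MapsTo T K K) (hKne : K.Nonempty) {c : ℝ} (hc : ∀ x ∈ K, c ≤ φ x) :
    c ≤ ⨆ x, φ' x := by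
  obtain ⟨χ, hχ, h⟩ := hcoh
  obtain ⟨x, hx⟩ := hKne
  obtain ⟨C, hC⟩ := isCompact_univ.exists_bound_of_continuousOn hχ.continuousOn
  by_contra! hlt
  obtain ⟨n, hn⟩ := exists_nat_gt (2 * C / (c - ⨆ x, φ' x))
  rw [div_lt_iff₀ (sub_pos.2 hlt)] at hn
  have h1 : birkhoffSum T φ' n x ≤ n * ⨆ x, φ' x := by
    simpa [birkhoffSum] using Finset.sum_le_card_nsmul (Finset.range n)
      (fun j => φ' (T^[j] x)) _ fun j _ => le_ciSup (isCompact_range hφ').bddAbove (T^[j] x)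
  have h2 : n * c ≤ birkhoffSum T φ n x := by
    simpa [birkhoffSum] using Finset.card_nsmul_le_sum (Finset.range n)
      (fun j => φ (T^[j] x)) c fun j _ => hc _ (hK.iterate j hx)
  have h3 := birkhoffSum_eq_of_coboundary h n x
  have h4 := abs_le.1 (hC x (mem_univ x))
  have h5 := abs_le.1 (hC (T^[n] x) (mem_univ _))
  linarith

lemma Cohomologous.neg {X : Type*} [TopologicalSpace X] {T : X → X} {φ φ' : X → ℝ}
    (h : Cohomologous T φ φ') : Cohomologous T (fun x => -φ x) (fun x => -φ' x) := by
  obtain ⟨χ, hχ, h⟩ := h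
  exact ⟨fun x => -χ x, hχ.neg, fun x => by simp only [h]; ring⟩

lemma iInf_le_of_cohomologous {X : Type*} [TopologicalSpace X] [CompactSpace X] {T : X → X}
    {φ φ' : X → ℝ} (hφ' : Continuous φ') (hcoh : Cohomologous T φ φ') {K : Set X}
    (hK : MapsTo T K K) (hKne : K.Nonempty) {c : ℝ} (hc : ∀ x ∈ K, φ x ≤ c) :
    ⨅ x, φ' x ≤ c := by
  have := le_iSup_of_cohomologous hφ'.neg hcoh.neg hK hKne fun x hx => neg_le_neg (hc x hx)
  have hneg : ⨆ x, -φ' x ≤ -⨅ x, φ' x := by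
    have : Nonempty X := hKne.to_type
    exact ciSup_le fun x => neg_le_neg (ciInf_le (isCompact_range hφ').bddBelow x)
  exact neg_le_neg_iff.1 (this.trans hneg)

end ThermoFormalism

theorem mainTheorem7 {X : Type*} [MetricSpace X] [CompactSpace X] [MeasurableSpace X]
    [BorelSpace X] (T : X → X) (hT : Continuous T) (h : ℝ) (hh : 0 < h)
    (X' X'' : Set X) (hX'c : IsCompact X') (hX''c : IsCompact X'') (hX''ne : X''.Nonempty)
    (hdisj : Disjoint X' X'') (hX' : Set.MapsTo T X' X') (hX'' : Set.MapsTo T X'' X'')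
    (hent : 0 < ThermoFormalism.topEntropy (hX'.restrict T X' X'))
    (φ : X → ℝ) (hφ : Continuous φ) (hφle : ∀ x, φ x ≤ 0) (hφX' : ∀ x ∈ X', φ x = 0)
    (hφX'' : sSup (φ '' X'') < -h) :
    ((⨆ x, φ x : ℝ) : EReal) < ThermoFormalism.pressure T φ ∧
    (∀ φ' : X → ℝ, Continuous φ' → ThermoFormalism.Cohomologous T φ φ' →
      h < ThermoFormalism.oscillation φ') ∧
    (∀ ψ : X → ℝ, Continuous ψ → ThermoFormalism.BoundedRange T ψ →
      ((⨆ x, ψ x : ℝ) : EReal) < ThermoFormalism.pressure T ψ ∧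
        ThermoFormalism.IsHyperbolic T ψ) ∧
    (ThermoFormalism.topEntropy T < ⊤ →
      ∃ ψ : X → ℝ, Continuous ψ ∧
        ((⨆ x, ψ x : ℝ) : EReal) < ThermoFormalism.pressure T ψ ∧
        ThermoFormalism.IsHyperbolic T ψ ∧
        ∀ ψ' : X → ℝ, Continuous ψ' → ThermoFormalism.Cohomologous T ψ ψ' →
          ¬ ThermoFormalism.BoundedRange T ψ') := by
  have hX'ne := ThermoFormalism.nonempty_of_topEntropy_pos hT hX'c hX' hent
  -- Applied both to `φ` and to a function that separates `X'` and `X''` by more than the entropy.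
  have hosc : ∀ (s : ℝ) (ψ : X → ℝ), (∀ x ∈ X', ψ x = 0) → (∀ x ∈ X'', ψ x ≤ s) →
      ∀ ψ' : X → ℝ, Continuous ψ' → ThermoFormalism.Cohomologous T ψ ψ' →
        -s ≤ ThermoFormalism.oscillation ψ' := by
    intro s ψ h' h'' ψ' hψ' hcoh
    have h1 := ThermoFormalism.le_iSup_of_cohomologous hψ' hcoh hX' hX'ne fun x hx => (h' x hx).ge
    have h2 := ThermoFormalism.iInf_le_of_cohomologous hψ' hcoh hX'' hX''ne h''
    rw [ThermoFormalism.oscillation]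
    linarith
  refine ⟨ThermoFormalism.iSup_lt_pressure_of_eq_zero_on hT hX'c hX' hent hφle hφX', ?_, ?_, ?_⟩
  · intro φ' hφ' hcoh
    have := hosc _ φ hφX' (fun x hx => le_csSup (hX''c.image hφ).bddAbove (mem_image_of_mem φ hx))
      φ' hφ' hcoh
    linarith
  · intro ψ hψ hbr
    have := ThermoFormalism.iSup_lt_pressure_of_boundedRange hT hψ hbr
    exact ⟨this, ThermoFormalism.isHyperbolic_of_iSup_lt_pressure this⟩
  · intro htop
    have hpos : 0 < ThermoFormalism.topEntropy T := by
      refine hent.trans_le ?_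
      rw [ThermoFormalism.topEntropy, Dynamics.coverEntropy_restrict]
      exact Dynamics.coverEntropy_monotone T (subset_univ X')
    obtain ⟨H, hH⟩ : ∃ H : ℝ, (H : EReal) = ThermoFormalism.topEntropy T :=
      ⟨_, EReal.coe_toReal htop.ne (ne_bot_of_gt hpos)⟩
    have hH0 : 0 < H := by rw [← hH] at hpos; exact_mod_cast hpos
    obtain ⟨g, hg', hg'', hg⟩ := exists_continuous_zero_one_of_isClosed hX'c.isClosed
      hX''c.isClosed hdisj
    have hψX' : ∀ x ∈ X', -(H * g x) = 0 := fun x hx => by simp [hg' hx]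
    have hψX'' : ∀ x ∈ X'', -(H * g x) ≤ -H := fun x hx => by simp [hg'' hx]
    have hlt := ThermoFormalism.iSup_lt_pressure_of_eq_zero_on hT hX'c hX' hent
      (fun x => neg_nonpos.2 (mul_nonneg hH0.le (hg x).1)) hψX'
    refine ⟨fun x => -(H * g x), (g.continuous.const_mul H).neg, hlt,
      ThermoFormalism.isHyperbolic_of_iSup_lt_pressure hlt, fun ψ' hψ' hcoh hbr => ?_⟩
    have h1 := hosc _ _ hψX' hψX'' ψ' hψ' hcoh
    rw [ThermoFormalism.BoundedRange, ← hH, EReal.coe_lt_coe_iff] at hbr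
    linarith
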